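/- Let $p\ge 1$ and $\Omega=\mathbb{R}^p$ with the Euclidean norm. Let $\mathcal{P}_2^{\mathrm{Leb}}([0,1]\times\Omega)$ be the set of Borel probability measures $\mu$ on $[0,1]\times\Omega$ with finite second moment whose marginal on $[0,1]$ is the Lebesgue measure. A disintegration of such a $\mu$ is a measurable family $(\mu(\cdot|s))_{s\in[0,1]}$ of Borel probability measures on $\Omega$ with $\mathrm{d}\mu(s,\omega)=\mu(\mathrm{d}\omega|s)\,\mathrm{d}s$; it exists and is unique up to a Lebesgue-null set of $s$. For Borel probability measures $\nu,\nu'$ on $\Omega$ let $$W_2(\nu,\nu')=\Big(\inf_{\gamma\in\Gamma(\nu,\nu')}\int_{\Omega\times\Omega}\|\omega-\omega'\|^2\,\mathrm{d}\gamma(\omega,\omega')\Big)^{1/2}\in[0,\infty],$$ where $\Gamma(\nu,\nu')$ is the set of Borel probability measures on $\Omega\times\Omega$ with marginals $\nu$ and $\nu'$. For $\mu,\mu'\in\mathcal{P}_2^{\mathrm{Leb}}([0,1]\times\Omega)$ set $$d(\mu,\mu')=\Big(\int_0^1 W_2\big(\mu(\cdot|s),\mu'(\cdot|s)\big)^2\,\mathrm{d}s\Big)^{1/2}.$$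 Then $d$ is well defined: for all $\mu,\mu'\in\mathcal{P}_2^{\mathrm{Leb}}([0,1]\times\Omega)$ and all disintegrations of them, $\mu(\cdot|s)$ and $\mu'(\cdot|s)$ have finite second moment for almost every $s$, the function $s\mapsto W_2(\mu(\cdot|s),\mu'(\cdot|s))^2$ is measurable, its integral over $[0,1]$ is finite, and the value $d(\mu,\mu')$ does not depend on the chosen disintegrations. Moreover, $d$ is a metric on $\mathcal{P}_2^{\mathrm{Leb}}([0,1]\times\Omega)$ (the conditional optimal transport distance). -/

import Mathlib

open MeasureTheory ProbabilityTheory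
open scoped ENNReal unitInterval

namespace CondOT

/-- `μ` has a finite moment of order two: `∫ d(x, x₀)² dμ(x) < ∞` for some base point `x₀`
(for a finite measure, equivalently for every base point). -/
def FiniteSecondMoment {X : Type*} [PseudoEMetricSpace X] [MeasurableSpace X]
    (μ : Measure X) : Prop :=
  ∃ x₀ : X, ∫⁻ x, edist x x₀ ^ 2 ∂μ < ∞

/-- The set `Γ(μ, ν)` of couplings: probability measures on `X × X` with marginals `μ` and `ν`. -/
def couplings {X : Type*} [MeasurableSpace X] (μ ν : Measure X) : Set (Measure (X × X)) :=
  {γ | IsProbabilityMeasure γ ∧ γ.map Prod.fst = μ ∧ γ.map Prod.snd = ν}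

/-- The Wasserstein distance of order two, with values in `[0, ∞]`:
`W₂(μ, ν) = (inf_{γ ∈ Γ(μ, ν)} ∫ d(x, y)² dγ(x, y))^{1/2}`. -/
noncomputable def W₂ {X : Type*} [PseudoEMetricSpace X] [MeasurableSpace X]
    (μ ν : Measure X) : ℝ≥0∞ :=
  (⨅ γ ∈ couplings μ ν, ∫⁻ z, edist z.1 z.2 ^ 2 ∂γ) ^ (1 / 2 : ℝ)

/-- The set `𝒫₂^Leb([0,1] × ℝᵖ)` of Borel probability measures on `[0,1] × ℝᵖ` with finite moment
of order two whose first marginal is the Lebesgue measure on `[0,1]`. -/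
def P₂Leb (p : ℕ) : Type :=
  {μ : ProbabilityMeasure (I × EuclideanSpace ℝ (Fin p)) //
    FiniteSecondMoment (μ : Measure (I × EuclideanSpace ℝ (Fin p))) ∧
    (μ : Measure (I × EuclideanSpace ℝ (Fin p))).map Prod.fst = (volume : Measure I)}

/-- The underlying measure on `[0,1] × ℝᵖ`. -/
def P₂Leb.toMeasure {p : ℕ} (μ : P₂Leb p) : Measure (I × EuclideanSpace ℝ (Fin p)) :=
  (μ.1 : Measure (I × EuclideanSpace ℝ (Fin p)))

instance {p : ℕ} (μ : P₂Leb p) : IsProbabilityMeasure μ.toMeasure :=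
  inferInstanceAs (IsProbabilityMeasure (μ.1 : Measure (I × EuclideanSpace ℝ (Fin p))))

/-- The family `s ↦ κ s` is a disintegration of `μ` with respect to the Lebesgue measure on
`[0,1]`: a measurable family of probability measures on `ℝᵖ` with `dμ(s, ω) = κ(s)(dω) ds`. -/
def IsDisintegration {p : ℕ} (μ : P₂Leb p) (κ : Kernel I (EuclideanSpace ℝ (Fin p))) : Prop :=
  IsMarkovKernel κ ∧ (volume : Measure I) ⊗ₘ κ = μ.toMeasure

/-- A disintegration `s ↦ μ(·|s)` of `μ`. -/
noncomputable def P₂Leb.cond {p : ℕ} (μ : P₂Leb p) : Kernel I (EuclideanSpace ℝ (Fin p)) :=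
  μ.toMeasure.condKernel

theorem P₂Leb.isDisintegration_cond {p : ℕ} (μ : P₂Leb p) : IsDisintegration μ μ.cond := by
  refine ⟨inferInstanceAs (IsMarkovKernel μ.toMeasure.condKernel), ?_⟩
  have h : μ.toMeasure.fst = (volume : Measure I) := μ.2.2
  rw [← h]
  exact μ.toMeasure.disintegrate μ.toMeasure.condKernel

/-- `∫₀¹ W₂(κ(s), η(s))² ds`, with values in `[0, ∞]`. -/
noncomputable def sqCost {p : ℕ} (κ η : Kernel I (EuclideanSpace ℝ (Fin p))) : ℝ≥0∞ :=
  ∫⁻ s : I, W₂ (κ s) (η s) ^ 2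

/-- The conditional optimal transport distance
`d(μ, ν) = (∫₀¹ W₂(μ(·|s), ν(·|s))² ds)^{1/2}`. -/
noncomputable def d {p : ℕ} (μ ν : P₂Leb p) : ℝ :=
  Real.sqrt (sqCost μ.cond ν.cond).toReal

end CondOT

/-!
The proof rests on three facts about `W₂`: it satisfies the axioms of a distance on probability
measures, it depends measurably on its arguments, and `d` is an `L²` norm of `W₂`.

*Distance.* The triangle inequality comes from gluing two plans along their common marginal
(`exists_gluing`, by disintegration) and Minkowski's inequality. For definiteness no optimal plan
is needed: a plan of cost below `ε ^ 3` moves mass at most `ε` over distances at least `ε`, so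
`W₂ μ ν = 0` forces the Lévy–Prokhorov distance to vanish (`eq_of_W₂_eq_zero`).

*Measurability.* It is required at every parameter, including those where the second moments are
infinite, so approximation by measures with finite moments does not suffice. Instead, the
underlying space is embedded as an open subset of a compact metrizable space `K`: Euclidean space
is homeomorphic to the open unit ball, which lies in the closed one. The quadratic cost extended
by zero to `K × K` is lower semicontinuous, and the extension does not change the optimal cost,
since all plans are concentrated on the image (`W₂_sq_eq_iInf_extCost`). The probability measures
on `K × K` form a compact space on which the cost functional is lower semicontinuous, so the pairs
of marginals of plans of cost at most `c` form a closed set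
(`isClosed_marginals_of_lintegral_le`), and the strict sublevel sets of `W₂ ^ 2` are countable
unions of closed sets. Weakly open sets are Giry measurable, because the space of probability
measures on `K` is second countable (`opensMeasurableSpace_probabilityMeasure`).

*Integration.* Minkowski's inequality in `L²([0,1])` gives the triangle inequality for the
integrated cost (`sqCost_triangle`). Comparison with constant families of Dirac masses, whose cost
is a second moment, gives finiteness (`sqCost_lt_top`). Two disintegrations of the same measure
agree almost everywhere, whence independence of the choice; conversely, vanishing cost makes the
conditional measures agree almost everywhere, and these determine the measure.
-/

namespace CondOT

open Set Filter Topology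
open scoped NNReal

/-! ### Weak convergence of probability measures on a compact space -/

section Weak

variable {K : Type*} [TopologicalSpace K] [MeasurableSpace K]

/-- The weakly open sets are generated by evaluation at bounded continuous functions, which are
Giry measurable; second countability turns this into a countable generation. -/
theorem opensMeasurableSpace_probabilityMeasure [OpensMeasurableSpace K]
    [SecondCountableTopology (ProbabilityMeasure K)] :
    OpensMeasurableSpace (ProbabilityMeasure K) := by
  let S : Set (Set (ProbabilityMeasure K)) := {U | IsOpen U ∧ MeasurableSet U}
  have hS : (inferInstance : TopologicalSpace (ProbabilityMeasure K)) = .generateFrom S := by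
    refine le_antisymm (le_generateFrom fun U hU => hU.1) ?_
    have hcont {Y : Type _} [TopologicalSpace Y] (g : Y → ProbabilityMeasure K)
        (hg : ∀ f, Continuous fun y => (g y).toFiniteMeasure.testAgainstNN f) : Continuous g :=
      continuous_induced_rng.2 (continuous_induced_rng.2
        (WeakDual.continuous_of_continuous_eval hg))
    refine continuous_id_iff_le.1 (@hcont _ (.generateFrom S) id fun f => ?_)
    refine continuous_def.2 fun V hV => TopologicalSpace.isOpen_generateFrom_of_mem ⟨?_, ?_⟩
    · exact hV.preimage (ProbabilityMeasure.continuous_testAgainstNN_eval f)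
    · have hm : Measurable fun μ : ProbabilityMeasure K =>
          (∫⁻ x, f x ∂(μ : Measure K)).toNNReal :=
        ((Measure.measurable_lintegral (by fun_prop)).comp measurable_subtype_coe).ennreal_toNNReal
      exact hm hV.measurableSet
  constructor
  rw [borel_eq_generateFrom_of_subbasis hS]
  exact MeasurableSpace.generateFrom_le fun U hU => hU.2

theorem secondCountableTopology_probabilityMeasure [CompactSpace K]
    [TopologicalSpace.PseudoMetrizableSpace K] [BorelSpace K] [T2Space K] :
    SecondCountableTopology (ProbabilityMeasure K) := by
  have : TopologicalSpace.SeparableSpace K := by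
    let _ := TopologicalSpace.pseudoMetrizableSpacePseudoMetric K
    infer_instance
  let _ := TopologicalSpace.pseudoMetrizableSpacePseudoMetric (ProbabilityMeasure K)
  infer_instance

/-- Half of the portmanteau theorem for lower semicontinuous nonnegative integrands: by the layer
cake formula it reduces to the open superlevel sets. -/
theorem isClosed_lintegral_ofReal_le [TopologicalSpace.PseudoMetrizableSpace K] [BorelSpace K]
    [TopologicalSpace.SeparableSpace K] {f : K → ℝ} (hf : LowerSemicontinuous f) (hf0 : 0 ≤ f)
    (c : ℝ≥0∞) :
    IsClosed {γ : ProbabilityMeasure K | ∫⁻ x, ENNReal.ofReal (f x) ∂(γ : Measure K) ≤ c} := by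
  let _ := TopologicalSpace.pseudoMetrizableSpacePseudoMetric (ProbabilityMeasure K)
  let _ := TopologicalSpace.pseudoMetrizableSpacePseudoMetric K
  refine IsSeqClosed.isClosed fun γs γ hγs hlim => ?_
  have hm (μ : ProbabilityMeasure K) : AEMeasurable f μ := hf.measurable.aemeasurable
  calc ∫⁻ x, ENNReal.ofReal (f x) ∂(γ : Measure K)
      = ∫⁻ t in Ioi (0 : ℝ), (γ : Measure K) {a | t < f a} :=
        lintegral_eq_lintegral_meas_lt _ (.of_forall hf0) (hm γ)
    _ ≤ ∫⁻ t in Ioi (0 : ℝ), atTop.liminf fun n => (γs n : Measure K) {a | t < f a} :=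
        lintegral_mono fun t =>
          ProbabilityMeasure.le_liminf_measure_open_of_tendsto hlim (hf.isOpen_preimage t)
    _ ≤ atTop.liminf fun n => ∫⁻ t in Ioi (0 : ℝ), (γs n : Measure K) {a | t < f a} :=
        lintegral_liminf_le fun n => Antitone.measurable fun s t hst =>
          measure_mono fun x hx => lt_of_le_of_lt hst hx
    _ ≤ c := by
        refine liminf_le_of_frequently_le' (Frequently.of_forall fun n => ?_)
        rw [← lintegral_eq_lintegral_meas_lt _ (.of_forall hf0) (hm (γs n))]
        exact hγs n

/-- On a compact space the pairs of marginals of the plans of cost at most `c` form a closed set,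
being the continuous image of a compact set. -/
theorem isClosed_marginals_of_lintegral_le [CompactSpace K] [T2Space K] [BorelSpace K]
    [TopologicalSpace.PseudoMetrizableSpace K] {f : K × K → ℝ} (hf : LowerSemicontinuous f)
    (hf0 : 0 ≤ f) (c : ℝ≥0∞) :
    IsClosed {m : ProbabilityMeasure K × ProbabilityMeasure K |
      ∃ γ ∈ couplings (m.1 : Measure K) (m.2 : Measure K),
        ∫⁻ z, ENNReal.ofReal (f z) ∂γ ≤ c} := by
  have : SecondCountableTopology K := by
    let _ := TopologicalSpace.pseudoMetrizableSpacePseudoMetric K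
    infer_instance
  have hcl := (isClosed_lintegral_ofReal_le (K := K × K) hf hf0 c).isCompact
  have hcont : Continuous fun γ : ProbabilityMeasure (K × K) =>
      (γ.map continuous_fst.measurable.aemeasurable,
        γ.map continuous_snd.measurable.aemeasurable) :=
    (ProbabilityMeasure.continuous_map continuous_fst).prodMk
      (ProbabilityMeasure.continuous_map continuous_snd)
  convert (hcl.image hcont).isClosed using 1
  ext ⟨μ, ν⟩
  constructor
  · rintro ⟨γ, ⟨hγ, h1, h2⟩, hc⟩
    exact ⟨⟨γ, hγ⟩, hc, Prod.ext (Subtype.ext h1) (Subtype.ext h2)⟩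
  · rintro ⟨γ, hc, h⟩
    exact ⟨γ, ⟨γ.2, congrArg (fun m => (m.1 : Measure K)) h,
      congrArg (fun m => (m.2 : Measure K)) h⟩, hc⟩

end Weak

/-! ### Measurable dependence of the Wasserstein distance on parameters -/

section Measurability

theorem W₂_sq {X : Type*} [PseudoEMetricSpace X] [MeasurableSpace X] (μ ν : Measure X) :
    W₂ μ ν ^ 2 = ⨅ γ ∈ couplings μ ν, ∫⁻ z, edist z.1 z.2 ^ 2 ∂γ := by
  rw [W₂, ← ENNReal.rpow_natCast, ← ENNReal.rpow_mul]
  norm_num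

theorem map_mem_couplings {X Y : Type*} [MeasurableSpace X] [MeasurableSpace Y] {μ ν : Measure X}
    {γ : Measure (X × X)} (hγ : γ ∈ couplings μ ν) {f : X → Y} (hf : Measurable f) :
    γ.map (Prod.map f f) ∈ couplings (μ.map f) (ν.map f) := by
  obtain ⟨hγ, rfl, rfl⟩ := hγ
  refine ⟨Measure.isProbabilityMeasure_map (by fun_prop), ?_, ?_⟩ <;>
  · rw [Measure.map_map (by fun_prop) (by fun_prop), Measure.map_map (by fun_prop) (by fun_prop)]
    rfl

variable {X K : Type*} [PseudoMetricSpace X]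

/-- The quadratic cost of `X` transported to `K` by `j` with left inverse `r`, and extended by zero.
It is lower semicontinuous when `j` is an open embedding, even though it need not be bounded
near the boundary of the image. -/
noncomputable def extCost (j : X → K) (r : K → X) : K × K → ℝ :=
  (range (Prod.map j j)).indicator fun z => dist (r z.1) (r z.2) ^ 2

theorem extCost_nonneg (j : X → K) (r : K → X) : 0 ≤ extCost j r :=
  fun _ => indicator_nonneg (fun _ _ => by positivity) _

theorem extCost_apply {j : X → K} {r : K → X} (hr : ∀ x, r (j x) = x) (z : X × X) :
    extCost j r (Prod.map j j z) = dist z.1 z.2 ^ 2 := by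
  rw [extCost, indicator_of_mem (mem_range_self z)]
  simp [hr]

theorem lowerSemicontinuous_extCost [TopologicalSpace K] {j : X → K} (hj : IsOpenEmbedding j)
    {r : K → X} (hr : ∀ x, r (j x) = x) : LowerSemicontinuous (extCost j r) := by
  have hjj := hj.prodMap hj
  rw [lowerSemicontinuous_iff_isOpen_preimage]
  intro t
  rcases lt_or_ge t 0 with ht | ht
  · convert isOpen_univ
    exact eq_univ_of_forall fun z => ht.trans_le (extCost_nonneg j r z)
  · convert hjj.isOpenMap {z : X × X | t < dist z.1 z.2 ^ 2}
      (isOpen_lt continuous_const (by fun_prop))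
    ext z
    constructor
    · intro hz
      have hzr : z ∈ range (Prod.map j j) := by
        by_contra h
        have : extCost j r z = 0 := indicator_of_notMem h _
        exact (ht.trans_lt hz).ne' this
      obtain ⟨w, rfl⟩ := hzr
      exact ⟨w, by simpa [extCost_apply hr] using hz, rfl⟩
    · rintro ⟨w, hw, rfl⟩
      simpa [extCost_apply hr] using hw

/-- Plans on `X` and plans between the image measures on `K` have the same optimal cost: a plan on
`K` is concentrated on the image of `X × X`, and pulls back along the left inverse `r`. -/
theorem W₂_sq_eq_iInf_extCost [MeasurableSpace X] [BorelSpace X] [SecondCountableTopology X]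
    [TopologicalSpace K] [MeasurableSpace K] [BorelSpace K] [SecondCountableTopology K] {j : X → K}
    (hj : IsOpenEmbedding j) {r : K → X} (hrm : Measurable r) (hr : ∀ x, r (j x) = x)
    (μ ν : Measure X) :
    W₂ μ ν ^ 2 = ⨅ γ ∈ couplings (μ.map j) (ν.map j), ∫⁻ z, ENNReal.ofReal (extCost j r z) ∂γ := by
  have hjm : Measurable j := hj.continuous.measurable
  have hjj : MeasurableEmbedding (Prod.map j j) := (hj.prodMap hj).measurableEmbedding
  have hcost (z : X × X) :
      ENNReal.ofReal (extCost j r (Prod.map j j z)) = edist z.1 z.2 ^ 2 := by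
    rw [extCost_apply hr, edist_dist, ENNReal.ofReal_pow dist_nonneg]
  have hmap (γ : Measure (X × X)) : ∫⁻ z, ENNReal.ofReal (extCost j r z) ∂(γ.map (Prod.map j j)) =
      ∫⁻ z, edist z.1 z.2 ^ 2 ∂γ := by
    rw [hjj.lintegral_map]
    exact lintegral_congr hcost
  have hid (ρ : Measure X) : (ρ.map j).map r = ρ := by
    rw [Measure.map_map hrm hjm, show r ∘ j = id from funext hr, Measure.map_id]
  rw [W₂_sq]
  apply le_antisymm
  · refine le_iInf₂ fun γ hγ => ?_
    have hγ' : γ.map (Prod.map r r) ∈ couplings μ ν := by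
      simpa only [hid] using map_mem_couplings hγ hrm
    refine (iInf₂_le _ hγ').trans_eq ?_
    rw [← hmap, Measure.map_map (by fun_prop) (by fun_prop)]
    -- both marginals, hence also `γ`, are concentrated on the range of `j`
    have hrange (ρ : Measure X) : ∀ᵐ y ∂(ρ.map j), j (r y) = y := by
      rw [hj.measurableEmbedding.ae_map_iff]
      exact .of_forall fun x => by rw [hr]
    have h1 : ∀ᵐ z ∂γ, j (r z.1) = z.1 := by
      have := hrange μ
      rw [← hγ.2.1] at this
      exact ae_of_ae_map measurable_fst.aemeasurable this
    have h2 : ∀ᵐ z ∂γ, j (r z.2) = z.2 := by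
      have := hrange ν
      rw [← hγ.2.2] at this
      exact ae_of_ae_map measurable_snd.aemeasurable this
    have : (Prod.map j j ∘ Prod.map r r) =ᵐ[γ] id := by
      filter_upwards [h1, h2] with z hz1 hz2 using Prod.ext hz1 hz2
    rw [Measure.map_congr this, Measure.map_id]
  · refine le_iInf₂ fun γ hγ => ?_
    exact (iInf₂_le _ (map_mem_couplings hγ hjm)).trans_eq (hmap γ)

/-- If `X` embeds as an open subset of a compact metrizable space, the sublevel sets of the optimal
cost are countable unions of closed sets of pairs of marginals. -/
theorem measurable_W₂_sq_of_isOpenEmbedding [MeasurableSpace X] [BorelSpace X]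
    [SecondCountableTopology X] [Nonempty X] [TopologicalSpace K] [MeasurableSpace K]
    [CompactSpace K] [T2Space K] [BorelSpace K] [TopologicalSpace.PseudoMetrizableSpace K]
    {j : X → K} (hj : IsOpenEmbedding j) {S : Type*} [MeasurableSpace S] (κ η : Kernel S X)
    [IsMarkovKernel κ] [IsMarkovKernel η] : Measurable fun s => W₂ (κ s) (η s) ^ 2 := by
  have : SecondCountableTopology K := by
    let _ := TopologicalSpace.pseudoMetrizableSpacePseudoMetric K
    infer_instance
  have := secondCountableTopology_probabilityMeasure (K := K)
  have := opensMeasurableSpace_probabilityMeasure (K := K)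
  have hjm : Measurable j := hj.continuous.measurable
  obtain ⟨r, hrm, hr⟩ := hj.measurableEmbedding.exists_measurable_extend measurable_id
    fun _ => inferInstance
  replace hr : ∀ x, r (j x) = x := congrFun hr
  let push (θ : Kernel S X) [IsMarkovKernel θ] (s : S) : ProbabilityMeasure K :=
    ⟨(θ s).map j, Measure.isProbabilityMeasure_map hjm.aemeasurable⟩
  have hpush (θ : Kernel S X) [IsMarkovKernel θ] : Measurable (push θ) :=
    ((Measure.measurable_map j hjm).comp θ.measurable).subtype_mk
  simp only [W₂_sq_eq_iInf_extCost hj hrm hr]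
  refine measurable_of_Iio fun t => ?_
  have hunion : (fun s => ⨅ γ ∈ couplings ((κ s).map j) ((η s).map j),
      ∫⁻ z, ENNReal.ofReal (extCost j r z) ∂γ) ⁻¹' Iio t =
      ⋃ q : ℚ, ⋃ _ : (Real.toNNReal q : ℝ≥0∞) < t, (fun s => (push κ s, push η s)) ⁻¹'
        {m | ∃ γ ∈ couplings (m.1 : Measure K) (m.2 : Measure K),
          ∫⁻ z, ENNReal.ofReal (extCost j r z) ∂γ ≤ (Real.toNNReal q : ℝ≥0∞)} := by
    ext s
    simp only [mem_preimage, mem_Iio, iInf_lt_iff, mem_iUnion, mem_ofPred_eq, exists_prop]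
    constructor
    · rintro ⟨γ, hγ, hlt⟩
      obtain ⟨q, -, hq1, hq2⟩ := ENNReal.lt_iff_exists_rat_btwn.1 hlt
      exact ⟨q, hq2, γ, hγ, hq1.le⟩
    · rintro ⟨q, hq, γ, hγ, hle⟩
      exact ⟨γ, hγ, hle.trans_lt hq⟩
  rw [hunion]
  refine .iUnion fun q => .iUnion fun _ => ((hpush κ).prodMk (hpush η)) ?_
  exact (isClosed_marginals_of_lintegral_le (lowerSemicontinuous_extCost hj hr)
    (extCost_nonneg j r) _).measurableSet

/-- Euclidean space is homeomorphic to the open unit ball, an open subset of the closed unit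
ball. -/
theorem measurable_W₂_sq {E : Type*} [NormedAddCommGroup E] [NormedSpace ℝ E]
    [FiniteDimensional ℝ E] [MeasurableSpace E] [BorelSpace E] {S : Type*} [MeasurableSpace S]
    (κ η : Kernel S E) [IsMarkovKernel κ] [IsMarkovKernel η] :
    Measurable fun s => W₂ (κ s) (η s) ^ 2 := by
  have : ProperSpace E := FiniteDimensional.proper ℝ E
  have : CompactSpace (Metric.closedBall (0 : E) 1) :=
    isCompact_iff_compactSpace.1 (isCompact_closedBall _ _)
  have hsub : Metric.ball (0 : E) 1 ⊆ Metric.closedBall 0 1 := Metric.ball_subset_closedBall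
  have hincl : IsOpenEmbedding (inclusion hsub) := by
    refine ⟨.inclusion _, ?_⟩
    rw [range_inclusion]
    exact Metric.isOpen_ball.preimage continuous_subtype_val
  have hj := hincl.comp Homeomorph.unitBall.isOpenEmbedding
  exact measurable_W₂_sq_of_isOpenEmbedding hj κ η

end Measurability

/-! ### The Wasserstein distance of order two -/

section Wasserstein

variable {X : Type*} [MeasurableSpace X]

theorem swap_mem_couplings {μ ν : Measure X} {γ : Measure (X × X)} (hγ : γ ∈ couplings μ ν) :
    γ.map Prod.swap ∈ couplings ν μ := by
  obtain ⟨hγ, rfl, rfl⟩ := hγ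
  refine ⟨Measure.isProbabilityMeasure_map (by fun_prop), ?_, ?_⟩ <;>
  · rw [Measure.map_map (by fun_prop) (by fun_prop)]
    rfl

/-- Gluing of plans: a law on `X × X × X` whose marginals on the first two and on the last two
factors are two given plans. The outer variables are independent given the middle one. -/
theorem exists_gluing [StandardBorelSpace X] [Nonempty X] {μ ν ρ : Measure X}
    {γ₁ γ₂ : Measure (X × X)} (h₁ : γ₁ ∈ couplings μ ν) (h₂ : γ₂ ∈ couplings ν ρ) :
    ∃ π : Measure (X × X × X), π.map (fun z => (z.1, z.2.1)) = γ₁ ∧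
      π.map (fun z => (z.2.1, z.2.2)) = γ₂ := by
  have := h₁.1
  have := h₂.1
  have hν : IsProbabilityMeasure ν := h₁.2.2 ▸ Measure.isProbabilityMeasure_map (by fun_prop)
  obtain ⟨hs, hs1, -⟩ := swap_mem_couplings h₁
  set κ₁ := (γ₁.map Prod.swap).condKernel
  set κ₂ := γ₂.condKernel
  have e₁ : ν ⊗ₘ κ₁ = γ₁.map Prod.swap := by
    have := (γ₁.map Prod.swap).disintegrate κ₁
    rwa [Measure.fst, hs1] at this
  have e₂ : ν ⊗ₘ κ₂ = γ₂ := by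
    have := γ₂.disintegrate κ₂
    rwa [Measure.fst, h₂.2.1] at this
  refine ⟨(ν ⊗ₘ (κ₁ ×ₖ κ₂)).map fun w => (w.2.1, w.1, w.2.2), ?_, ?_⟩
  · have : (ν ⊗ₘ (κ₁ ×ₖ κ₂)).map (Prod.map id Prod.fst) = γ₁.map Prod.swap := by
      rw [← Measure.compProd_map measurable_fst, ← Kernel.fst_eq, Kernel.fst_prod, e₁]
    rw [Measure.map_map (by fun_prop) (by fun_prop)]
    calc _ = ((ν ⊗ₘ (κ₁ ×ₖ κ₂)).map (Prod.map id Prod.fst)).map Prod.swap := by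
          rw [Measure.map_map (by fun_prop) (by fun_prop)]; rfl
      _ = γ₁ := by
          rw [this, Measure.map_map (by fun_prop) (by fun_prop), Prod.swap_swap_eq, Measure.map_id]
  · have : (ν ⊗ₘ (κ₁ ×ₖ κ₂)).map (Prod.map id Prod.snd) = γ₂ := by
      rw [← Measure.compProd_map measurable_snd, ← Kernel.snd_eq, Kernel.snd_prod, e₂]
    rw [Measure.map_map (by fun_prop) (by fun_prop)]
    exact this

theorem W₂_le_of_mem_couplings [PseudoEMetricSpace X] {μ ν : Measure X} {γ : Measure (X × X)}
    (hγ : γ ∈ couplings μ ν) :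
    W₂ μ ν ≤ (∫⁻ z, edist z.1 z.2 ^ (2 : ℝ) ∂γ) ^ (1 / 2 : ℝ) := by
  simp only [ENNReal.rpow_ofNat]
  exact ENNReal.rpow_le_rpow (iInf₂_le _ hγ) (by norm_num)

theorem exists_mem_couplings_of_W₂_lt [PseudoEMetricSpace X] {μ ν : Measure X} {c : ℝ≥0∞}
    (h : W₂ μ ν < c) :
    ∃ γ ∈ couplings μ ν, (∫⁻ z, edist z.1 z.2 ^ (2 : ℝ) ∂γ) ^ (1 / 2 : ℝ) < c := by
  simp only [ENNReal.rpow_ofNat]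
  rw [W₂, one_div, ENNReal.rpow_inv_lt_iff (by norm_num)] at h
  simp only [iInf_lt_iff, exists_prop, ENNReal.rpow_ofNat] at h
  obtain ⟨γ, hγ, hlt⟩ := h
  refine ⟨γ, hγ, ?_⟩
  rwa [one_div, ENNReal.rpow_inv_lt_iff (by norm_num), ENNReal.rpow_ofNat]

theorem W₂_comm [PseudoEMetricSpace X] [OpensMeasurableSpace X] [SecondCountableTopology X]
    (μ ν : Measure X) : W₂ μ ν = W₂ ν μ := by
  have h (μ ν : Measure X) : W₂ μ ν ≤ W₂ ν μ := by
    refine le_of_forall_gt fun c hc => ?_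
    obtain ⟨γ, hγ, hlt⟩ := exists_mem_couplings_of_W₂_lt hc
    refine (W₂_le_of_mem_couplings (swap_mem_couplings hγ)).trans_lt ?_
    rw [lintegral_map (by fun_prop) (by fun_prop)]
    simpa only [Prod.fst_swap, Prod.snd_swap, edist_comm] using hlt
  exact le_antisymm (h μ ν) (h ν μ)

theorem W₂_self [PseudoEMetricSpace X] [OpensMeasurableSpace X] [SecondCountableTopology X]
    (μ : Measure X) [IsProbabilityMeasure μ] : W₂ μ μ = 0 := by
  have hγ : μ.map (fun x => (x, x)) ∈ couplings μ μ := by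
    refine ⟨Measure.isProbabilityMeasure_map (by fun_prop), ?_, ?_⟩ <;>
    · rw [Measure.map_map (by fun_prop) (by fun_prop)]
      exact Measure.map_id
  refine nonpos_iff_eq_zero.1 ((W₂_le_of_mem_couplings hγ).trans_eq ?_)
  rw [lintegral_map (by fun_prop) (by fun_prop)]
  simp

theorem W₂_triangle [PseudoEMetricSpace X] [OpensMeasurableSpace X] [SecondCountableTopology X]
    [StandardBorelSpace X] [Nonempty X] (μ ν ρ : Measure X) :
    W₂ μ ρ ≤ W₂ μ ν + W₂ ν ρ := by
  refine ENNReal.le_of_forall_pos_le_add fun ε hε hfin => ?_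
  have hε' : (ε / 2 : ℝ≥0∞) ≠ 0 := by simpa using hε.ne'
  have ha : W₂ μ ν < W₂ μ ν + ε / 2 :=
    ENNReal.lt_add_right (ne_top_of_le_ne_top hfin.ne le_self_add) hε'
  have hb : W₂ ν ρ < W₂ ν ρ + ε / 2 :=
    ENNReal.lt_add_right (ne_top_of_le_ne_top hfin.ne le_add_self) hε'
  obtain ⟨γ₁, h₁, hlt₁⟩ := exists_mem_couplings_of_W₂_lt ha
  obtain ⟨γ₂, h₂, hlt₂⟩ := exists_mem_couplings_of_W₂_lt hb
  obtain ⟨π, rfl, rfl⟩ := exists_gluing h₁ h₂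
  have hπ : π.map (fun z => (z.1, z.2.2)) ∈ couplings μ ρ := by
    obtain ⟨hp, e₁, -⟩ := h₁
    obtain ⟨-, -, e₂⟩ := h₂
    have : IsProbabilityMeasure π :=
      (Measure.isProbabilityMeasure_map_iff (by fun_prop)).1 hp
    rw [Measure.map_map (by fun_prop) (by fun_prop)] at e₁ e₂
    refine ⟨Measure.isProbabilityMeasure_map (by fun_prop), ?_, ?_⟩
    · rw [← e₁, Measure.map_map (by fun_prop) (by fun_prop)]; rfl
    · rw [← e₂, Measure.map_map (by fun_prop) (by fun_prop)]; rfl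
  rw [lintegral_map (by fun_prop) (by fun_prop)] at hlt₁ hlt₂
  calc W₂ μ ρ ≤ (∫⁻ z, edist z.1 z.2.2 ^ (2 : ℝ) ∂π) ^ (1 / 2 : ℝ) := by
        refine (W₂_le_of_mem_couplings hπ).trans_eq ?_
        rw [lintegral_map (by fun_prop) (by fun_prop)]
    _ ≤ (∫⁻ z, ((fun z : X × X × X => edist z.1 z.2.1) + fun z : X × X × X => edist z.2.1 z.2.2) z
          ^ (2 : ℝ) ∂π) ^ (1 / 2 : ℝ) := by
        gcongr with z
        exact edist_triangle _ _ _
    _ ≤ (∫⁻ z, edist z.1 z.2.1 ^ (2 : ℝ) ∂π) ^ (1 / 2 : ℝ) +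
          (∫⁻ z, edist z.2.1 z.2.2 ^ (2 : ℝ) ∂π) ^ (1 / 2 : ℝ) :=
        ENNReal.lintegral_Lp_add_le (by fun_prop) (by fun_prop) (by norm_num)
    _ ≤ (W₂ μ ν + ε / 2) + (W₂ ν ρ + ε / 2) := add_le_add hlt₁.le hlt₂.le
    _ = W₂ μ ν + W₂ ν ρ + ε := by rw [add_add_add_comm, ENNReal.add_halves]

/-- By Chebyshev's inequality a plan of small quadratic cost moves little mass far, so the
Lévy–Prokhorov distance of the marginals is small. -/
theorem eq_of_W₂_eq_zero [PseudoEMetricSpace X] [BorelSpace X] [SecondCountableTopology X]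
    {μ ν : Measure X} [IsProbabilityMeasure μ] [IsProbabilityMeasure ν] (h : W₂ μ ν = 0) :
    μ = ν := by
  have hLP : levyProkhorovEDist μ ν = 0 := by
    refine nonpos_iff_eq_zero.1 (levyProkhorovEDist_le_of_forall_le μ ν 0 fun ε B hε hεt hB => ?_)
    -- a plan of cost below `ε ^ 3` moves mass at most `ε ^ 3 / ε ^ 2 = ε` over distances `≥ ε`
    obtain ⟨γ, hγ, hlt⟩ := exists_mem_couplings_of_W₂_lt (μ := μ) (ν := ν)
      (c := (ε ^ (3 : ℝ)) ^ (1 / 2 : ℝ)) (by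
        rw [h]; exact ENNReal.rpow_pos (ENNReal.rpow_pos hε hεt.ne) (by finiteness))
    have hcost : ∫⁻ z, edist z.1 z.2 ^ (2 : ℝ) ∂γ ≤ ε ^ (3 : ℝ) :=
      ((ENNReal.rpow_lt_rpow_iff (by norm_num)).1 hlt).le
    obtain ⟨hp, rfl, rfl⟩ := hγ
    have hfar : γ {z | ε ^ (2 : ℝ) ≤ edist z.1 z.2 ^ (2 : ℝ)} ≤ ε := by
      have hpos : ε ^ (2 : ℝ) ≠ 0 := (ENNReal.rpow_pos hε hεt.ne).ne'
      refine (ENNReal.mul_le_mul_iff_right hpos (by finiteness)).1 ?_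
      refine (mul_meas_ge_le_lintegral (by fun_prop) _).trans (hcost.trans_eq ?_)
      conv_rhs => rw [← ENNReal.rpow_one ε, ← ENNReal.rpow_mul, ← ENNReal.rpow_add _ _ hε.ne' hεt.ne]
      norm_num
    rw [Measure.map_apply measurable_fst hB,
      Measure.map_apply measurable_snd Metric.isOpen_thickening.measurableSet]
    refine (measure_mono fun z hz => ?_).trans ((measure_union_le _ _).trans
      (add_le_add_right hfar _))
    rcases lt_or_ge (edist z.1 z.2) ε with hz' | hz'
    · refine .inl ((Metric.mem_thickening_iff_exists_edist_lt _ _).2 ⟨z.1, hz, ?_⟩)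
      rwa [ENNReal.ofReal_toReal hεt.ne, edist_comm]
    · exact .inr (ENNReal.rpow_le_rpow hz' (by norm_num))
  refine ext_of_generate_finite _ ?_ isPiSystem_isClosed (fun A hA => ?_) (by simp)
  · rw [BorelSpace.measurable_eq (α := X), borel_eq_generateFrom_isClosed]
  · exact measure_eq_measure_of_levyProkhorovEDist_eq_zero_of_isClosed hLP hA
      ⟨1, one_pos, measure_ne_top _ _⟩ ⟨1, one_pos, measure_ne_top _ _⟩

theorem W₂_sq_dirac_le [PseudoEMetricSpace X] [OpensMeasurableSpace X]
    [SecondCountableTopology X] (μ : Measure X) [IsProbabilityMeasure μ] (y : X) :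
    W₂ μ (.dirac y) ^ 2 ≤ ∫⁻ x, edist x y ^ 2 ∂μ := by
  have hγ : μ.map (fun x => (x, y)) ∈ couplings μ (.dirac y) := by
    refine ⟨Measure.isProbabilityMeasure_map (by fun_prop), ?_, ?_⟩ <;>
      rw [Measure.map_map (by fun_prop) (by fun_prop)]
    · exact Measure.map_id
    · exact (Measure.map_const μ y).trans (by simp)
  rw [W₂_sq]
  refine (iInf₂_le _ hγ).trans_eq ?_
  rw [lintegral_map (by fun_prop) (by fun_prop)]

end Wasserstein

/-! ### The conditional optimal transport distance -/

section Conditional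

variable {p : ℕ}

/-- The pointwise triangle inequality for `W₂`, integrated by Minkowski's inequality in `L²`. -/
theorem sqCost_triangle (κ η θ : Kernel I (EuclideanSpace ℝ (Fin p)))
    [IsMarkovKernel κ] [IsMarkovKernel η] [IsMarkovKernel θ] :
    sqCost κ θ ^ (1 / 2 : ℝ) ≤ sqCost κ η ^ (1 / 2 : ℝ) + sqCost η θ ^ (1 / 2 : ℝ) := by
  have hm (κ η : Kernel I (EuclideanSpace ℝ (Fin p))) [IsMarkovKernel κ] [IsMarkovKernel η] :
      AEMeasurable (fun s => W₂ (κ s) (η s)) volume := by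
    have h := (measurable_W₂_sq κ η).pow_const (1 / 2 : ℝ)
    simp only [← ENNReal.rpow_natCast, ← ENNReal.rpow_mul] at h
    norm_num at h
    exact h.aemeasurable
  have h := ENNReal.lintegral_Lp_add_le (hm κ η) (hm η θ) one_le_two
  simp only [ENNReal.rpow_ofNat] at h
  refine le_trans ?_ h
  rw [sqCost]
  gcongr with s
  exact W₂_triangle _ _ _

theorem sqCost_comm (κ η : Kernel I (EuclideanSpace ℝ (Fin p))) : sqCost κ η = sqCost η κ := by
  simp only [sqCost, W₂_comm]

theorem sqCost_self (κ : Kernel I (EuclideanSpace ℝ (Fin p))) [IsMarkovKernel κ] :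
    sqCost κ κ = 0 := by
  simp [sqCost, W₂_self]

theorem ae_eq_of_sqCost_eq_zero {κ η : Kernel I (EuclideanSpace ℝ (Fin p))} [IsMarkovKernel κ]
    [IsMarkovKernel η] (h : sqCost κ η = 0) : κ =ᵐ[volume] η := by
  filter_upwards [(lintegral_eq_zero_iff (measurable_W₂_sq κ η)).1 h] with s hs
  exact eq_of_W₂_eq_zero (pow_eq_zero_iff two_ne_zero |>.1 hs)

theorem IsDisintegration.ae_eq {μ : P₂Leb p} {κ η : Kernel I (EuclideanSpace ℝ (Fin p))}
    (hκ : IsDisintegration μ κ) (hη : IsDisintegration μ η) : κ =ᵐ[volume] η := by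
  have := hκ.1
  have := hη.1
  exact Kernel.ae_eq_of_compProd_eq (hκ.2.trans hη.2.symm)

theorem sqCost_eq_of_isDisintegration {μ ν : P₂Leb p}
    {κ κ' η η' : Kernel I (EuclideanSpace ℝ (Fin p))} (hκ : IsDisintegration μ κ)
    (hκ' : IsDisintegration μ κ') (hη : IsDisintegration ν η) (hη' : IsDisintegration ν η') :
    sqCost κ η = sqCost κ' η' := by
  refine lintegral_congr_ae ?_
  filter_upwards [hκ.ae_eq hκ', hη.ae_eq hη'] with s h₁ h₂
  rw [h₁, h₂]

/-- The second moment of `μ` bounds the integrated second moments of its conditional measures. -/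
theorem IsDisintegration.exists_lintegral_lt_top {μ : P₂Leb p}
    {κ : Kernel I (EuclideanSpace ℝ (Fin p))} (hκ : IsDisintegration μ κ) :
    ∃ y, ∫⁻ s : I, ∫⁻ x, edist x y ^ 2 ∂(κ s) < ∞ := by
  have := hκ.1
  obtain ⟨z, hz⟩ := μ.2.1
  refine ⟨z.2, lt_of_le_of_lt ?_ hz⟩
  change _ ≤ ∫⁻ x, edist x z ^ 2 ∂μ.toMeasure
  rw [← hκ.2, Measure.lintegral_compProd (by fun_prop)]
  gcongr with s x
  exact le_max_right _ _

theorem IsDisintegration.ae_finiteSecondMoment {μ : P₂Leb p}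
    {κ : Kernel I (EuclideanSpace ℝ (Fin p))} (hκ : IsDisintegration μ κ) :
    ∀ᵐ s : I, FiniteSecondMoment (κ s) := by
  obtain ⟨y, hy⟩ := hκ.exists_lintegral_lt_top
  have hm : Measurable fun s => ∫⁻ x, edist x y ^ 2 ∂(κ s) :=
    Measurable.lintegral_kernel (by fun_prop)
  filter_upwards [ae_lt_top hm hy.ne] with s hs using ⟨y, hs⟩

theorem rpow_half_lt_top_of_le {a b : ℝ≥0∞} (h : a ≤ b) (hb : b < ∞) : a ^ (1 / 2 : ℝ) < ∞ :=
  ENNReal.rpow_lt_top_of_nonneg (by norm_num) (h.trans_lt hb).ne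

/-- Finiteness of the cost, by comparison with constant families of Dirac masses. -/
theorem sqCost_lt_top {μ ν : P₂Leb p} {κ η : Kernel I (EuclideanSpace ℝ (Fin p))}
    (hκ : IsDisintegration μ κ) (hη : IsDisintegration ν η) : sqCost κ η < ∞ := by
  have := hκ.1
  have := hη.1
  obtain ⟨x, hx⟩ := hκ.exists_lintegral_lt_top
  obtain ⟨y, hy⟩ := hη.exists_lintegral_lt_top
  let δ (z : EuclideanSpace ℝ (Fin p)) : Kernel I (EuclideanSpace ℝ (Fin p)) :=
    Kernel.const I (.dirac z)
  have hδ (θ : Kernel I (EuclideanSpace ℝ (Fin p))) [IsMarkovKernel θ]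
      (z : EuclideanSpace ℝ (Fin p)) : sqCost θ (δ z) ≤ ∫⁻ s : I, ∫⁻ w, edist w z ^ 2 ∂(θ s) :=
    lintegral_mono fun s => W₂_sq_dirac_le (θ s) z
  have h₁ := rpow_half_lt_top_of_le (hδ κ x) hx
  have h₂ := rpow_half_lt_top_of_le (hδ (δ x) y)
    (by simp [δ, lintegral_dirac' x (f := fun w => edist w y ^ 2) (by fun_prop), edist_lt_top])
  have h₃ := rpow_half_lt_top_of_le (hδ η y) hy
  have h := (sqCost_triangle κ (δ y) η).trans
    (add_le_add_left (sqCost_triangle κ (δ x) (δ y)) _)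
  rw [sqCost_comm (δ y) η] at h
  have hlt := h.trans_lt (ENNReal.add_lt_top.2 ⟨ENNReal.add_lt_top.2 ⟨h₁, h₂⟩, h₃⟩)
  exact (ENNReal.rpow_lt_top_iff_of_pos (by norm_num)).1 hlt

instance (μ : P₂Leb p) : IsMarkovKernel μ.cond := μ.isDisintegration_cond.1

theorem sqCost_cond_lt_top (μ ν : P₂Leb p) : sqCost μ.cond ν.cond < ∞ :=
  sqCost_lt_top μ.isDisintegration_cond ν.isDisintegration_cond

theorem d_eq_toReal (μ ν : P₂Leb p) : d μ ν = (sqCost μ.cond ν.cond ^ (1 / 2 : ℝ)).toReal := by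
  rw [d, Real.sqrt_eq_rpow, ENNReal.toReal_rpow]

theorem d_triangle (μ ν ρ : P₂Leb p) : d μ ρ ≤ d μ ν + d ν ρ := by
  have hlt (μ ν : P₂Leb p) : sqCost μ.cond ν.cond ^ (1 / 2 : ℝ) ≠ ∞ :=
    (rpow_half_lt_top_of_le le_rfl (sqCost_cond_lt_top μ ν)).ne
  simp only [d_eq_toReal]
  rw [← ENNReal.toReal_add (hlt μ ν) (hlt ν ρ)]
  exact ENNReal.toReal_mono (ENNReal.add_ne_top.2 ⟨hlt μ ν, hlt ν ρ⟩) (sqCost_triangle _ _ _)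

theorem eq_of_d_eq_zero {μ ν : P₂Leb p} (h : d μ ν = 0) : μ = ν := by
  rw [d, Real.sqrt_eq_zero ENNReal.toReal_nonneg, ENNReal.toReal_eq_zero_iff] at h
  have hae := ae_eq_of_sqCost_eq_zero (h.resolve_right (sqCost_cond_lt_top μ ν).ne)
  have heq : μ.toMeasure = ν.toMeasure := by
    rw [← μ.isDisintegration_cond.2, ← ν.isDisintegration_cond.2, Measure.compProd_congr hae]
  exact Subtype.ext (Subtype.ext heq)

end Conditional

end CondOT

theorem mainTheorem8 (p : ℕ) :
    -- `d` is well defined, whichever disintegrations are chosen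
    (∀ (μ ν : CondOT.P₂Leb p) (κ η : Kernel I (EuclideanSpace ℝ (Fin p))),
      CondOT.IsDisintegration μ κ → CondOT.IsDisintegration ν η →
        (∀ᵐ s : I, CondOT.FiniteSecondMoment (κ s) ∧ CondOT.FiniteSecondMoment (η s)) ∧
        Measurable (fun s : I => CondOT.W₂ (κ s) (η s) ^ 2) ∧
        CondOT.sqCost κ η < ∞ ∧
        CondOT.d μ ν = Real.sqrt (CondOT.sqCost κ η).toReal) ∧
    -- `d` is a metric
    (∃ m : MetricSpace (CondOT.P₂Leb p), ∀ μ ν : CondOT.P₂Leb p, m.dist μ ν = CondOT.d μ ν) := by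
  refine ⟨fun μ ν κ η hκ hη => ?_, ?_⟩
  · have := hκ.1
    have := hη.1
    refine ⟨hκ.ae_finiteSecondMoment.and hη.ae_finiteSecondMoment, CondOT.measurable_W₂_sq κ η,
      CondOT.sqCost_lt_top hκ hη, ?_⟩
    rw [CondOT.d, CondOT.sqCost_eq_of_isDisintegration μ.isDisintegration_cond hκ
      ν.isDisintegration_cond hη]
  · exact ⟨{
      dist := CondOT.d
      dist_self := fun μ => by simp [CondOT.d, CondOT.sqCost_self]
      dist_comm := fun μ ν => by simp only [CondOT.d, CondOT.sqCost_comm]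
      dist_triangle := CondOT.d_triangle
      eq_of_dist_eq_zero := CondOT.eq_of_d_eq_zero }, fun _ _ => rfl⟩
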